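/- Let $X \neq \{0\}$ be a real or complex Banach space, with closed unit ball $B_X$ and unit sphere $S_X$. For $x^* \in S_{X^*}$ and $\varepsilon > 0$ let \[S(x^*,\varepsilon) = \{x \in B_X : \operatorname{Re} x^*(x) > 1-\varepsilon\}.\] The space $X$ has the *local diameter 2 property +* (LD2P+) if for every $x^* \in S_{X^*}$, every $\varepsilon > 0$, every $\delta > 0$ and every $x \in S(x^*,\varepsilon) \cap S_X$ there exists $y \in S(x^*,\varepsilon)$ with $\|x-y\| > 2-\delta$. The space $X$ is *M-embedded* if $X^{***} = X^* \oplus_1 X^\perp$, that is, if $X^{***}$ is the direct sum of the canonical image of $X^*$ and the annihilator $X^\perp \subset X^{***}$ of the canonical image of $X$ in $X^{**}$, and $\|f+g\| = \|f\|+\|g\|$ for all $f \in X^*$ and $g \in X^\perp$. If $X$ is M-embedded, then $X$ does not have the LD2P+. -/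

import Mathlib

set_option maxSynthPendingDepth 3

namespace DiameterTwo

section Defs

variable {𝕜 : Type*} [RCLike 𝕜] {E : Type*} [NormedAddCommGroup E] [NormedSpace 𝕜 E]

/-- The slice `S(x*, ε) = {x ∈ B_E : Re x*(x) > 1 - ε}` of the closed unit ball of `E`.
Over the reals, the real part is the identity. -/
def slice (f : StrongDual 𝕜 E) (ε : ℝ) : Set E :=
  {x | ‖x‖ ≤ 1 ∧ 1 - ε < RCLike.re (f x)}

variable (𝕜 E) in
/-- The local diameter 2 property +. -/
def LD2PPlus : Prop :=
  ∀ f : StrongDual 𝕜 E, ‖f‖ = 1 → ∀ ε : ℝ, 0 < ε → ∀ δ : ℝ, 0 < δ →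
    ∀ x ∈ slice f ε, ‖x‖ = 1 → ∃ y ∈ slice f ε, 2 - δ < ‖x - y‖

/-- The annihilator `M^⊥ ⊆ F*` of a subspace `M` of `F`. -/
def annihilator {F : Type*} [AddCommMonoid F] [TopologicalSpace F] [Module 𝕜 F]
    (M : Submodule 𝕜 F) : Submodule 𝕜 (StrongDual 𝕜 F) where
  carrier := {f | ∀ x ∈ M, f x = 0}
  zero_mem' := fun _ _ => rfl
  add_mem' := fun {f g} hf hg x hx => by
    change f x + g x = 0
    rw [hf x hx, hg x hx, add_zero]
  smul_mem' := fun c f hf x hx => by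
    change c • f x = 0
    rw [hf x hx, smul_zero]

/-- `F = U ⊕₁ V`: the space `F` is the internal direct sum of the subspaces `U` and `V`, and
the norm of a sum of components is the sum of their norms. -/
def IsL1DirectSum {F : Type*} [NormedAddCommGroup F] [NormedSpace 𝕜 F]
    (U V : Submodule 𝕜 F) : Prop :=
  IsCompl U V ∧ ∀ u ∈ U, ∀ v ∈ V, ‖u + v‖ = ‖u‖ + ‖v‖

variable (𝕜 E) in
/-- The canonical image of `E` in its bidual. -/
noncomputable def canonicalImage : Submodule 𝕜 (StrongDual 𝕜 (StrongDual 𝕜 E)) :=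
  LinearMap.range (NormedSpace.inclusionInDoubleDual 𝕜 E).toLinearMap

variable (𝕜 E) in
/-- `E` is M-embedded: `E*** = E* ⊕₁ E^⊥`, where `E*` is identified with its canonical image
in `E***`, and `E^⊥` is the annihilator in `E***` of the canonical image of `E` in `E**`. -/
def IsMEmbedded : Prop :=
  IsL1DirectSum (canonicalImage 𝕜 (StrongDual 𝕜 E)) (annihilator (canonicalImage 𝕜 E))

end Defs

end DiameterTwo

/-!
In a space with the LD2P+ the norm is `κ`-rough for every `κ < 2`. Let `A` be a set of functionals
in the unit ball, of diameter less than `κ`. If the norm is `κ`-rough at `x`, then for suitable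
small `h` one of `x + h` and `x - h` is not normed by `A`, since the increase of the norm in the
directions `h` and `-h` would need two functionals that differ by more than the diameter of `A`.
Covering a separable set `D` of functionals by countably many such `A`, the Baire category theorem
gives points that are not normed by any member of `D`.

In an M-embedded space `X`, a functional in the unit ball of `X***` that attains its norm on `X`
has no component in `X^⊥`, so it belongs to `X*`. Choose a functional `f x` norming each point `x`
of a countable set `C`. A weak-star cluster point in `X***` of the functionals `f (x n)`, for a
sequence `x n` in `C` converging to `z`, norms `z`; hence it lies in `X*` and is a weak limit of
the functionals `f (x n)`, so by Mazur's theorem it belongs to the closed span of `f '' C`. This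
separable space therefore norms the closure of `C`, and `C` can be chosen such that the norm is
rough on it. Taking the closure of `C` in `X**` makes the Baire argument independent of the
completeness of `X`.
-/

open Filter Topology Metric NormedSpace Set

namespace DiameterTwo

section Rough

variable {E : Type*} [NormedAddCommGroup E] {κ : ℝ} {s : Set E}

/-- The norm is `κ`-rough on `s`, with increments that do not leave `s`. For `s = univ`, the
usual `κ`-roughness of the norm, which asks that
`limsup (‖x + h‖ + ‖x - h‖ - 2‖x‖) / ‖h‖ ≥ κ` as `h → 0` for every `x`, is this property for all
constants smaller than `κ`. -/
def IsRoughOn (κ : ℝ) (s : Set E) : Prop :=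
  ∀ x ∈ s, ∃ᶠ h in 𝓝[≠] (0 : E),
    (x + h ∈ s ∧ x - h ∈ s) ∧ 2 * ‖x‖ + κ * ‖h‖ ≤ ‖x + h‖ + ‖x - h‖

lemma exists_countable_stable {α ι : Type*} [Countable ι] (φ : ι → α → α) (a : α) :
    ∃ C : Set α, C.Countable ∧ a ∈ C ∧ ∀ x ∈ C, ∀ i, φ i x ∈ C := by
  refine ⟨range fun l : List ι => l.foldr φ a, countable_range _, ⟨[], rfl⟩, ?_⟩
  rintro _ ⟨l, rfl⟩ i
  exact ⟨i :: l, rfl⟩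

lemma IsRoughOn.exists_countable (hs : IsRoughOn κ (univ : Set E)) :
    ∃ C : Set E, C.Countable ∧ C.Nonempty ∧ IsRoughOn κ C := by
  choose h hlim hrough using fun x => exists_seq_forall_of_frequently (hs x (mem_univ x))
  obtain ⟨C, hC, h0, hstable⟩ := exists_countable_stable
    (Sum.elim (fun n x => x + h x n) (fun n x => x - h x n)) (0 : E)
  refine ⟨C, hC, ⟨0, h0⟩, fun x hx => (hlim x).frequently (Frequently.of_forall fun n => ?_)⟩
  exact ⟨⟨hstable x hx (.inl n), hstable x hx (.inr n)⟩, (hrough x n).2⟩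

lemma IsRoughOn.image {𝕜 F : Type*} [Semiring 𝕜] [Module 𝕜 E] [NormedAddCommGroup F] [Module 𝕜 F]
    (hs : IsRoughOn κ s) (J : E →ₗᵢ[𝕜] F) : IsRoughOn κ (J '' s) := by
  rintro _ ⟨x, hx, rfl⟩
  have hJ : Tendsto J (𝓝[≠] 0) (𝓝[≠] 0) := tendsto_nhdsWithin_iff.2
    ⟨(J.continuous.tendsto' 0 0 J.map_zero).mono_left nhdsWithin_le_nhds,
      eventually_mem_nhdsWithin.mono fun h hh => (map_ne_zero_iff J J.injective).2 hh⟩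
  refine hJ.frequently ((hs x hx).mono fun h ⟨⟨hadd, hsub⟩, hrough⟩ => ?_)
  simp only [← map_add, ← map_sub, J.norm_map]
  exact ⟨⟨mem_image_of_mem J hadd, mem_image_of_mem J hsub⟩, hrough⟩

end Rough

variable {𝕜 : Type*} [RCLike 𝕜] {E : Type*} [NormedAddCommGroup E] [NormedSpace 𝕜 E]

lemma re_apply_le_norm {f : StrongDual 𝕜 E} (hf : ‖f‖ ≤ 1) (x : E) : RCLike.re (f x) ≤ ‖x‖ :=
  (RCLike.re_le_norm _).trans ((f.le_of_opNorm_le hf x).trans_eq (one_mul _))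

section LD2PPlus

variable (𝕜) in
lemma add_mul_norm_sub_sub_one_le {u y : E} (hu : ‖u‖ ≤ 1) (hy : ‖y‖ ≤ 1) {r t : ℝ} (hr : 0 ≤ r)
    (ht : 0 ≤ t) : (r + t) * (‖u - y‖ - 1) ≤ ‖(r : 𝕜) • u - (t : 𝕜) • y‖ := by
  obtain ⟨g, hg, hgu⟩ := exists_dual_vector'' 𝕜 (u - y)
  have hsplit : RCLike.re (g u) + RCLike.re (g (-y)) = ‖u - y‖ := by
    rw [← map_add, ← map_add, ← sub_eq_add_neg, hgu, RCLike.ofReal_re]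
  have hgu_le : RCLike.re (g u) ≤ 1 := (re_apply_le_norm hg u).trans hu
  have hgy_le : RCLike.re (g (-y)) ≤ 1 := (re_apply_le_norm hg (-y)).trans (by rwa [norm_neg])
  calc (r + t) * (‖u - y‖ - 1)
      = r * (‖u - y‖ - 1) + t * (‖u - y‖ - 1) := add_mul _ _ _
    _ ≤ r * RCLike.re (g u) + t * RCLike.re (g (-y)) := by gcongr <;> linarith
    _ = RCLike.re (g ((r : 𝕜) • u - (t : 𝕜) • y)) := by simp [sub_eq_add_neg]
    _ ≤ ‖(r : 𝕜) • u - (t : 𝕜) • y‖ := re_apply_le_norm hg _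

lemma LD2PPlus.exists_le_norm_add_smul_and_sub_smul (H : LD2PPlus 𝕜 E) {u : E} (hu : ‖u‖ = 1)
    {δ : ℝ} (hδ : 0 < δ) :
    ∃ y : E, 1 - δ < ‖y‖ ∧ ‖y‖ ≤ 1 ∧ ∀ r t : ℝ, 0 ≤ r → 0 ≤ t →
      r + t * (1 - δ) ≤ ‖(r : 𝕜) • u + (t : 𝕜) • y‖ ∧
      (r + t) * (1 - δ) ≤ ‖(r : 𝕜) • u - (t : 𝕜) • y‖ := by
  obtain ⟨f, hf, hfu⟩ := exists_dual_vector 𝕜 u (by simp [hu])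
  replace hfu : RCLike.re (f u) = 1 := by rw [hfu, RCLike.ofReal_re, hu]
  obtain ⟨y, ⟨hy, hfy⟩, huy⟩ := H f hf δ hδ δ hδ u ⟨hu.le, by linarith⟩ hu
  refine ⟨y, hfy.trans_le (re_apply_le_norm hf.le y), hy, fun r t hr ht => ⟨?_, ?_⟩⟩
  · calc r + t * (1 - δ) ≤ r + t * RCLike.re (f y) := by gcongr
      _ = RCLike.re (f ((r : 𝕜) • u + (t : 𝕜) • y)) := by simp [hfu]
      _ ≤ ‖(r : 𝕜) • u + (t : 𝕜) • y‖ := re_apply_le_norm hf.le _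
  · calc (r + t) * (1 - δ) ≤ (r + t) * (‖u - y‖ - 1) :=
        mul_le_mul_of_nonneg_left (by linarith) (add_nonneg hr ht)
      _ ≤ ‖(r : 𝕜) • u - (t : 𝕜) • y‖ := add_mul_norm_sub_sub_one_le 𝕜 hu.le hy hr ht

variable (𝕜) in
lemma exists_norm_eq_one_and_norm_smul_eq [Nontrivial E] (x : E) :
    ∃ u : E, ‖u‖ = 1 ∧ (‖x‖ : 𝕜) • u = x := by
  rcases eq_or_ne x 0 with rfl | hx
  · obtain ⟨v, hv⟩ := exists_ne (0 : E)
    exact ⟨(‖v‖⁻¹ : 𝕜) • v, norm_smul_inv_norm hv, by simp⟩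
  · exact ⟨(‖x‖⁻¹ : 𝕜) • x, norm_smul_inv_norm hx, smul_inv_smul₀ (by simpa using hx) x⟩

lemma LD2PPlus.isRoughOn_univ [Nontrivial E] (H : LD2PPlus 𝕜 E) {κ : ℝ} (hκ : κ < 2) :
    IsRoughOn κ (univ : Set E) := by
  intro x _
  rw [(nhdsWithin_hasBasis nhds_basis_ball _).frequently_iff]
  intro r hr
  obtain ⟨u, hu, hux⟩ := exists_norm_eq_one_and_norm_smul_eq 𝕜 x
  obtain ⟨t, ht, htr⟩ := exists_between hr
  have hden : 0 < (4 - κ) * t + ‖x‖ := by have := norm_nonneg x; nlinarith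
  obtain ⟨δ, hδ, hδx⟩ : ∃ δ > 0, δ * ((4 - κ) * t + ‖x‖) = (2 - κ) * t :=
    ⟨(2 - κ) * t / ((4 - κ) * t + ‖x‖), div_pos (mul_pos (by linarith) ht) hden,
      div_mul_cancel₀ _ hden.ne'⟩
  have hδ1 : δ < 1 := by
    by_contra! h
    nlinarith [norm_nonneg x]
  obtain ⟨y, hδy, hy, hnorm⟩ := H.exists_le_norm_add_smul_and_sub_smul hu hδ
  obtain ⟨hadd, hsub⟩ := hnorm ‖x‖ t (norm_nonneg x) ht.le
  rw [hux] at hadd hsub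
  have hth : ‖(t : 𝕜) • y‖ = t * ‖y‖ := by rw [norm_smul, RCLike.norm_ofReal, abs_of_pos ht]
  refine ⟨(t : 𝕜) • y, ⟨?_, ?_⟩, ⟨mem_univ _, mem_univ _⟩, ?_⟩
  · rw [mem_ball_zero_iff, hth]
    exact (mul_le_of_le_one_right ht.le hy).trans_lt htr
  · have hy0 : 0 < ‖y‖ := by linarith
    exact norm_pos_iff.1 (hth ▸ mul_pos ht hy0)
  · have hlow : (2 - κ) * (t * (1 - δ)) ≤ (2 - κ) * (t * ‖y‖) := by gcongr
    have hup : t * ‖y‖ ≤ t := mul_le_of_le_one_right ht.le hy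
    calc 2 * ‖x‖ + κ * ‖(t : 𝕜) • y‖
        = 2 * ‖x‖ + 2 * (t * ‖y‖) - (2 - κ) * (t * ‖y‖) := by rw [hth]; ring
      _ ≤ 2 * ‖x‖ + 2 * t - (2 - κ) * (t * (1 - δ)) := by linarith
      _ = ‖x‖ + t * (1 - δ) + (‖x‖ + t) * (1 - δ) := by linear_combination hδx
      _ ≤ ‖x + (t : 𝕜) • y‖ + ‖x - (t : 𝕜) • y‖ := add_le_add hadd hsub

end LD2PPlus

section NotNormedBy

variable {A : Set (StrongDual 𝕜 E)} {κ : ℝ} {s : Set E}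

/-- The points `x` at which `Re f(x)`, for `f ∈ A`, stays below `‖x‖` by a margin `ε` that does not
depend on `f`. The margin makes this set open, so that the Baire category theorem applies to it. -/
def notNormedBy (A : Set (StrongDual 𝕜 E)) : Set E :=
  {x | ∃ ε > 0, ∀ f ∈ A, RCLike.re (f x) + ε ≤ ‖x‖}

lemma isOpen_notNormedBy (hA : A ⊆ closedBall 0 1) : IsOpen (notNormedBy A) := by
  refine isOpen_iff.2 fun x ⟨ε, hε, hx⟩ => ⟨ε / 3, by positivity, fun z hz => ?_⟩
  refine ⟨ε / 3, by positivity, fun f hf => ?_⟩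
  rw [mem_ball, dist_eq_norm] at hz
  have hfz : RCLike.re (f z) - RCLike.re (f x) ≤ ‖z - x‖ := by
    rw [← map_sub, ← map_sub]
    exact re_apply_le_norm (mem_closedBall_zero_iff.1 (hA hf)) _
  have hxz : ‖x‖ - ‖z‖ ≤ ‖z - x‖ := norm_sub_rev x z ▸ norm_sub_norm_le x z
  linarith [hx f hf]

lemma add_mem_or_sub_mem_notNormedBy (hA : A ⊆ closedBall 0 1) {η : ℝ}
    (hdiam : ∀ f ∈ A, ∀ g ∈ A, ‖f - g‖ ≤ η) (hη : η < κ) {x h : E} (hh : h ≠ 0)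
    (hrough : 2 * ‖x‖ + κ * ‖h‖ ≤ ‖x + h‖ + ‖x - h‖) :
    x + h ∈ notNormedBy A ∨ x - h ∈ notNormedBy A := by
  by_contra! hcon
  simp only [notNormedBy, mem_ofPred_eq, not_exists, not_and, not_forall, not_le] at hcon
  have hε : 0 < (κ - η) * ‖h‖ / 2 := by have := norm_pos_iff.2 hh; have := sub_pos.2 hη; positivity
  obtain ⟨f, hfA, hf⟩ := hcon.1 _ hε
  obtain ⟨g, hgA, hg⟩ := hcon.2 _ hε
  have hfx := re_apply_le_norm (mem_closedBall_zero_iff.1 (hA hfA)) x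
  have hgx := re_apply_le_norm (mem_closedBall_zero_iff.1 (hA hgA)) x
  have hfg : RCLike.re (f h) - RCLike.re (g h) ≤ η * ‖h‖ := by
    rw [← map_sub, ← sub_apply]
    exact (RCLike.re_le_norm _).trans ((f - g).le_of_opNorm_le (hdiam f hfA g hgA) h)
  rw [map_add, map_add] at hf
  rw [map_sub, map_sub] at hg
  linarith

lemma IsRoughOn.subset_closure_inter_notNormedBy (hs : IsRoughOn κ s) (hA : A ⊆ closedBall 0 1)
    {η : ℝ} (hdiam : ∀ f ∈ A, ∀ g ∈ A, ‖f - g‖ ≤ η) (hη : η < κ) :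
    s ⊆ closure (s ∩ notNormedBy A) := by
  intro x hx
  rw [mem_closure_iff_frequently]
  have hadd : Tendsto (fun h : E => x + h) (𝓝[≠] 0) (𝓝 x) :=
    ((continuous_const_add x).tendsto' 0 x (add_zero x)).mono_left nhdsWithin_le_nhds
  have hsub : Tendsto (fun h : E => x - h) (𝓝[≠] 0) (𝓝 x) :=
    ((continuous_sub_left x).tendsto' 0 x (sub_zero x)).mono_left nhdsWithin_le_nhds
  have hor : ∃ᶠ h in 𝓝[≠] (0 : E),
      x + h ∈ s ∩ notNormedBy A ∨ x - h ∈ s ∩ notNormedBy A := by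
    refine ((hs x hx).and_eventually self_mem_nhdsWithin).mono ?_
    rintro h ⟨⟨⟨hxadd, hxsub⟩, hrough⟩, hh⟩
    exact (add_mem_or_sub_mem_notNormedBy hA hdiam hη hh hrough).imp (⟨hxadd, ·⟩) (⟨hxsub, ·⟩)
  exact (frequently_or_distrib.1 hor).elim hadd.frequently hsub.frequently

lemma dense_preimage_val_closure {t : Set E} (h : s ⊆ closure (s ∩ t)) :
    Dense (((↑) : closure s → E) ⁻¹' t) := by
  rw [Subtype.dense_iff, Subtype.image_preimage_coe]
  exact closure_minimal
    (h.trans (closure_mono (inter_subset_inter_left t subset_closure))) isClosed_closure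

lemma IsRoughOn.exists_forall_re_apply_lt_norm [CompleteSpace E] (hs : IsRoughOn κ s) (hκ : 0 < κ)
    (hne : s.Nonempty) {D : Set (StrongDual 𝕜 E)} (hD : TopologicalSpace.IsSeparable D) :
    ∃ z ∈ closure s, ∀ f ∈ D, ‖f‖ ≤ 1 → RCLike.re (f z) < ‖z‖ := by
  obtain ⟨Q, hQ, hDQ⟩ := hD
  let A (d : StrongDual 𝕜 E) : Set (StrongDual 𝕜 E) := closedBall 0 1 ∩ ball d (κ / 4)
  have hA (d) : A d ⊆ closedBall 0 1 := inter_subset_left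
  have hdiam (d) : ∀ f ∈ A d, ∀ g ∈ A d, ‖f - g‖ ≤ κ / 2 := fun f hf g hg => by
    have := dist_triangle_right f g d
    rw [dist_eq_norm f g] at this
    linarith [mem_ball.1 hf.2, mem_ball.1 hg.2]
  have : CompleteSpace (closure s) := isClosed_closure.completeSpace_coe
  have hdense : Dense (⋂ d ∈ Q, ((↑) : closure s → E) ⁻¹' notNormedBy (A d)) :=
    dense_biInter_of_isOpen
      (fun d _ => (isOpen_notNormedBy (hA d)).preimage continuous_subtype_val) hQ fun d _ =>
      dense_preimage_val_closure
        (hs.subset_closure_inter_notNormedBy (hA d) (hdiam d) (half_lt_self hκ))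
  have : Nonempty (closure s) := hne.closure.to_subtype
  obtain ⟨z, hz⟩ := hdense.nonempty
  refine ⟨z, z.2, fun f hf hf1 => ?_⟩
  obtain ⟨d, hd, hfd⟩ := mem_closure_iff.1 (hDQ hf) (κ / 4) (by positivity)
  obtain ⟨ε, hε, hzε⟩ := mem_iInter₂.1 hz d hd
  linarith [hzε f ⟨mem_closedBall_zero_iff.2 hf1, hfd⟩]

end NotNormedBy

section WeakLimits

variable {ι : Type*} {e : ι → E}

lemma exists_forall_tendsto_apply_of_norm_le (U : Ultrafilter ι) {r : ℝ} (he : ∀ i, ‖e i‖ ≤ r) :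
    ∃ F : StrongDual 𝕜 (StrongDual 𝕜 E), ‖F‖ ≤ r ∧
      ∀ Ψ : StrongDual 𝕜 E, Tendsto (fun i => Ψ (e i)) U (𝓝 (F Ψ)) := by
  let J (i : ι) : WeakDual 𝕜 (StrongDual 𝕜 E) :=
    StrongDual.toWeakDual (inclusionInDoubleDual 𝕜 E (e i))
  have hJ (i) : J i ∈ WeakDual.toStrongDual ⁻¹' closedBall 0 r :=
    mem_closedBall_zero_iff.2 ((double_dual_bound 𝕜 E (e i)).trans (he i))
  obtain ⟨F, hF, hUF⟩ := (WeakDual.isCompact_closedBall 0 r).ultrafilter_le_nhds (U.map J)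
    (le_principal_iff.2 (mem_map.2 (univ_mem' hJ)))
  exact ⟨WeakDual.toStrongDual F, mem_closedBall_zero_iff.1 hF,
    fun Ψ => ((WeakDual.eval_continuous Ψ).tendsto F).comp hUF⟩

lemma mem_of_forall_tendsto_apply {l : Filter ι} [l.NeBot] {M : Submodule 𝕜 E}
    (hM : IsClosed (M : Set E)) (he : ∀ i, e i ∈ M) {a : E}
    (hlim : ∀ Ψ : StrongDual 𝕜 E, Tendsto (fun i => Ψ (e i)) l (𝓝 (Ψ a))) : a ∈ M := by
  rw [← Submodule.Quotient.mk_eq_zero M]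
  refine SeparatingDual.eq_zero_of_forall_dual_eq_zero (R := 𝕜) fun g => ?_
  refine tendsto_nhds_unique (hlim (g.comp M.mkQL)) (tendsto_const_nhds.congr fun i => ?_)
  have hei : M.mkQ (e i) = 0 := (Submodule.Quotient.mk_eq_zero M).2 (he i)
  exact ((congrArg g hei).trans (map_zero g)).symm

end WeakLimits

section MEmbedded

lemma apply_eq_zero_of_mem_annihilator_of_mem_closure {M : Submodule 𝕜 E} {v : StrongDual 𝕜 E}
    (hv : v ∈ annihilator M) {z : E} (hz : z ∈ closure (M : Set E)) : v z = 0 :=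
  closure_minimal hv (isClosed_eq v.continuous continuous_const) hz

lemma IsL1DirectSum.mem_of_apply_eq_norm {U : Submodule 𝕜 (StrongDual 𝕜 E)} {M : Submodule 𝕜 E}
    (hUM : IsL1DirectSum U (annihilator M)) {F : StrongDual 𝕜 E} (hF : ‖F‖ ≤ 1) {z : E}
    (hz : z ∈ closure (M : Set E)) (hz0 : z ≠ 0) (hFz : F z = ‖z‖) : F ∈ U := by
  obtain ⟨hcompl, hnorm⟩ := hUM
  obtain ⟨u, hu, v, hv, rfl⟩ : ∃ u ∈ U, ∃ v ∈ annihilator M, u + v = F :=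
    Submodule.mem_sup.1 (hcompl.sup_eq_top ▸ Submodule.mem_top)
  have huz : u z = ‖z‖ := by
    rw [← hFz, add_apply, apply_eq_zero_of_mem_annihilator_of_mem_closure hv hz, add_zero]
  have hu1 : 1 ≤ ‖u‖ := by
    have := u.ratio_le_opNorm z
    rwa [huz, RCLike.norm_ofReal, abs_norm, div_self (norm_ne_zero_iff.2 hz0)] at this
  have hv0 : v = 0 := norm_le_zero_iff.1 (by linarith [hnorm u hu v hv])
  rwa [hv0, add_zero]

lemma tendsto_apply_norm_of_forall_apply_eq_norm {ι : Type*} {l : Filter ι}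
    {w : ι → StrongDual 𝕜 E} {z : StrongDual 𝕜 E} (hw : Tendsto w l (𝓝 z)) {e : ι → E}
    (he : ∀ i, ‖e i‖ ≤ 1) (hwe : ∀ i, w i (e i) = ‖w i‖) :
    Tendsto (fun i => z (e i)) l (𝓝 (‖z‖ : 𝕜)) := by
  have hnorm : Tendsto (fun i => w i (e i)) l (𝓝 (‖z‖ : 𝕜)) := by
    simp only [hwe]
    exact (RCLike.continuous_ofReal.tendsto _).comp hw.norm
  have hdiff : Tendsto (fun i => (w i - z) (e i)) l (𝓝 0) :=
    squeeze_zero_norm (fun i => (w i - z).unit_le_opNorm (e i) (he i))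
      (tendsto_iff_norm_sub_tendsto_zero.1 hw)
  simpa using hnorm.sub hdiff

lemma IsMEmbedded.exists_norming_mem_topologicalClosure_span (hE : IsMEmbedded 𝕜 E) {C : Set E}
    {f : E → StrongDual 𝕜 E} (hf : ∀ x, ‖f x‖ ≤ 1) (hfx : ∀ x, f x x = ‖x‖)
    {z : StrongDual 𝕜 (StrongDual 𝕜 E)} (hz : z ∈ closure (inclusionInDoubleDualLi 𝕜 '' C)) :
    ∃ g ∈ (Submodule.span 𝕜 (f '' C)).topologicalClosure, ‖g‖ ≤ 1 ∧ z g = ‖z‖ := by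
  rcases eq_or_ne z 0 with rfl | hz0
  · exact ⟨0, zero_mem _, by simp, by simp⟩
  obtain ⟨w, hwC, hwz⟩ := mem_closure_iff_seq_limit.1 hz
  choose x hxC hxw using hwC
  obtain ⟨F, hF, hlim⟩ := exists_forall_tendsto_apply_of_norm_le (𝕜 := 𝕜) (hyperfilter ℕ)
    (e := fun n => f (x n)) (fun n => hf (x n))
  have hFz : F z = ‖z‖ := by
    refine tendsto_nhds_unique (hlim z) (tendsto_apply_norm_of_forall_apply_eq_norm
      (hwz.mono_left Nat.hyperfilter_le_atTop) (fun n => hf (x n)) fun n => ?_)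
    rw [← hxw, LinearIsometry.norm_map]
    exact hfx (x n)
  have hzE : z ∈ closure (canonicalImage 𝕜 E : Set (StrongDual 𝕜 (StrongDual 𝕜 E))) :=
    closure_mono (image_subset_range _ _) hz
  obtain ⟨g, rfl⟩ := IsL1DirectSum.mem_of_apply_eq_norm hE hF hzE hz0 hFz
  refine ⟨g, ?_, ?_, hFz⟩
  · refine mem_of_forall_tendsto_apply (Submodule.isClosed_topologicalClosure _) (fun n => ?_) hlim
    exact Submodule.le_topologicalClosure _ (Submodule.subset_span (mem_image_of_mem f (hxC n)))
  · exact ((inclusionInDoubleDualLi 𝕜).norm_map g).symm.trans_le hF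

theorem IsMEmbedded.not_isRoughOn_univ (hE : IsMEmbedded 𝕜 E) {κ : ℝ} (hκ : 0 < κ) :
    ¬ IsRoughOn κ (univ : Set E) := by
  intro hrough
  obtain ⟨C, hC, hCne, hCrough⟩ := hrough.exists_countable
  choose f hf hfx using exists_dual_vector'' 𝕜 (E := E)
  have hsep : TopologicalSpace.IsSeparable
      ((Submodule.span 𝕜 (f '' C)).topologicalClosure : Set (StrongDual 𝕜 E)) :=
    ((hC.image f).isSeparable.span (R := 𝕜)).closure
  obtain ⟨z, hz, hlt⟩ := (hCrough.image (inclusionInDoubleDualLi 𝕜)).exists_forall_re_apply_lt_norm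
    hκ (hCne.image _) (hsep.image (inclusionInDoubleDualLi 𝕜).continuous)
  obtain ⟨g, hg, hg1, hgz⟩ := hE.exists_norming_mem_topologicalClosure_span hf hfx hz
  refine (hlt _ (mem_image_of_mem _ hg) ((LinearIsometry.norm_map _ g).trans_le hg1)).ne ?_
  exact (congrArg RCLike.re hgz).trans (RCLike.ofReal_re _)

end MEmbedded

end DiameterTwo

theorem mainTheorem4_general {𝕜 : Type*} [RCLike 𝕜] {X : Type*} [NormedAddCommGroup X]
    [NormedSpace 𝕜 X] [Nontrivial X] (hX : DiameterTwo.IsMEmbedded 𝕜 X) :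
    ¬ DiameterTwo.LD2PPlus 𝕜 X :=
  fun H => hX.not_isRoughOn_univ one_pos (H.isRoughOn_univ one_lt_two)

theorem mainTheorem4 {𝕜 : Type*} [RCLike 𝕜] {X : Type*} [NormedAddCommGroup X]
    [NormedSpace 𝕜 X] [CompleteSpace X] [Nontrivial X]
    (hX : DiameterTwo.IsMEmbedded 𝕜 X) : ¬ DiameterTwo.LD2PPlus 𝕜 X :=
  mainTheorem4_general hX
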